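/- A word is a finite, possibly empty, sequence of letters. A word $s$ is a factor of a word $w$ if $w=psq$ for some (possibly empty) words $p,q$, and a square is a word of the form $uu$; the empty word is a square. For a word $w$, let $S(w)$ denote the number of distinct square factors of $w$ (including the empty word), $|w|$ the length of $w$, and $|\mathrm{Alph}(w)|$ the number of distinct letters occurring in $w$. Then for every finite word $w$, $$S(w)\le |w|-|\mathrm{Alph}(w)|+1 .$$ Equivalently, the number of distinct nonempty square factors of $w$ is at most $|w|-|\mathrm{Alph}(w)|$. -/

import Mathlib

/-- A word `s` is a square if `s = u u` for some word `u`
(the empty word is a square, with `u` empty). -/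
def IsSquareWord {α : Type*} (s : List α) : Prop := ∃ u : List α, s = u ++ u

/-- The set of square factors of `w`: words `s` that are squares and satisfy `w = p s q` for some
words `p`, `q` (`List.IsInfix`). As a set of words, equal factors at different positions count
once, and the empty square is included. -/
def squareFactors {α : Type*} (w : List α) : Set (List α) :=
  {s | s <:+: w ∧ IsSquareWord s}

/-- The alphabet of `w`: the set of letters that occur in `w`. -/
def Alph {α : Type*} (w : List α) : Set α := {a | a ∈ w}

theorem squareFactors_finite {α : Type*} (w : List α) : (squareFactors w).Finite :=
  (List.finite_toSet w.sublists).subset fun _ hs => List.mem_sublists.2 hs.1.sublist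

theorem Alph_finite {α : Type*} (w : List α) : (Alph w).Finite :=
  List.finite_toSet w

/-- `S w` is the number of distinct square factors of `w`, the empty one included. -/
noncomputable def S {α : Type*} (w : List α) : ℕ := (squareFactors w).ncard

/-!
The proof counts independent cycles in the Rauzy graphs of `w`. The `n`-th Rauzy graph has the
factors of `w` of length `n` as vertices, and every factor `e` of length `n + 1` as an edge from its
prefix `e.take n` to its suffix `e.tail`. Walking along `w` visits every vertex, so the graph is
connected, and it keeps at least `#V - 1` edges after any deletion that leaves it connected.

The edges to delete come from Lyndon words. Let `f` be the periodic repetition of a Lyndon word of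
length `p ≤ n`. If all windows of `f` of length `n + 1` are factors of `w`, they form a circuit of
length `p` in the graph, and its distinguished edge is the window starting at the Lyndon word
(`circuitEdges`). A Lyndon word is unbordered (`IsLyndonSeq.not_period`), so this edge has no period
smaller than `p`; hence a second distinguished edge on the same circuit belongs to a circuit of
strictly smaller length. By induction on the length, the ends of each distinguished edge are still
connected once all of them are deleted (`eq_of_not_mem_circuitEdges`). Therefore
`#factors n + #circuitEdges n ≤ #factors (n + 1) + 1`, and summing over `1 ≤ n < |w|` bounds the
total number of distinguished edges by `|w| - |Alph w|` (`sum_ncard_circuitEdges_le`).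

It remains to inject the nonempty squares into the distinguished edges (`ncard_squares_le`). A
nonempty square is a window of length `2kp` of a unique Lyndon sequence `f` of period `p`, starting
at some phase `j < p`. If `m` phases give squares in `w` for the same `f` and `k`, then `m ≤ p`, and
by pigeonhole modulo `p` all windows of `f` of length `kp + m`, hence all shorter ones, are factors
of `w` (`window_isInfix_of_lt_card`). So `f` contributes a distinguished edge at each of the levels
`kp, …, kp + m - 1`, one for each of the `m` squares; since `m ≤ p`, different `k` use different
levels.
-/

open Function

/-- The word `f i, f (i + 1), …, f (i + n - 1)`. -/
def window {α : Type*} (f : ℕ → α) (i n : ℕ) : List α := (List.range n).map fun j => f (i + j)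

/-- The set of factors of `w` of length `n`: the vertices of the `n`-th Rauzy graph of `w`, and the
edges of the `(n - 1)`-st. -/
def factors {α : Type*} (w : List α) (n : ℕ) : Set (List α) := {s | s <:+: w ∧ s.length = n}

/-- `f` is the periodic repetition of a Lyndon word of length `p`: its first `p` letters form a word
strictly smaller, in the lexicographic order, than all its other rotations. The Lyndon word is kept
as the infinite sequence, so that its rotations are the windows `window f i p`. -/
structure IsLyndonSeq {α : Type*} [LinearOrder α] (f : ℕ → α) (p : ℕ) : Prop where
  pos : 0 < p
  periodic : Periodic f p
  lt_rotation : ∀ i, 0 < i → i < p → window f 0 p < window f i p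

/-- The distinguished edges of the `n`-th Rauzy graph of `w`. A Lyndon word of length `p ≤ n` gives a
circuit in this graph when all windows of length `n + 1` of its periodic repetition are factors of
`w`; the distinguished edge of this circuit is the window that starts at the Lyndon word. -/
def circuitEdges {α : Type*} [LinearOrder α] (w : List α) (n : ℕ) : Set (List α) :=
  {e | ∃ f p, IsLyndonSeq f p ∧ p ≤ n ∧ e = window f 0 (n + 1) ∧ ∀ i, window f i (n + 1) <:+: w}

/-! ### Windows of sequences -/

section Window
variable {α : Type*} {f g : ℕ → α} {p : ℕ}

@[simp] theorem length_window (f : ℕ → α) (i n : ℕ) : (window f i n).length = n := by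
  simp [window]

theorem window_add (f : ℕ → α) (i m n : ℕ) :
    window f i (m + n) = window f i m ++ window f (i + m) n := by
  simp [window, List.range_add, Function.comp_def, add_assoc]

theorem window_eq_window_iff {i j n : ℕ} :
    window f i n = window g j n ↔ ∀ t < n, f (i + t) = g (j + t) := by
  simp [window]

theorem window_isInfix {i n j m : ℕ} (h₁ : i ≤ j) (h₂ : j + m ≤ i + n) :
    window f j m <:+: window f i n := by
  obtain ⟨a, rfl⟩ := Nat.exists_eq_add_of_le h₁
  obtain ⟨b, rfl⟩ : ∃ b, n = a + m + b := ⟨n - (a + m), by omega⟩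
  rw [window_add, window_add]
  exact ⟨_, _, rfl⟩

theorem window_mod (hf : Periodic f p) (i n : ℕ) : window f (i % p) n = window f i n := by
  rw [window_eq_window_iff]; intro t _
  rw [← hf.map_mod_nat, Nat.mod_add_mod, hf.map_mod_nat]

theorem take_window (f : ℕ → α) (i n : ℕ) : (window f i (n + 1)).take n = window f i n := by
  rw [window_add, List.take_left' (length_window ..)]

theorem tail_window (f : ℕ → α) (i n : ℕ) : (window f i (n + 1)).tail = window f (i + 1) n := by
  rw [add_comm, window_add]; simp [window]

theorem eq_of_window_eq {q : ℕ} (hf : Periodic f p) (hg : Periodic g p) (hp : 0 < p)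
    (h : ∀ t < p, f t = g (q + t)) (t : ℕ) : f t = g (q + t) := by
  rw [← hf.map_mod_nat, h _ (Nat.mod_lt _ hp), ← hg.map_mod_nat, Nat.add_mod_mod, hg.map_mod_nat]

end Window

/-! ### Lyndon sequences -/

section Lyndon
variable {α : Type*} [LinearOrder α] {f g : ℕ → α} {p q : ℕ}

theorem append_lt_append_right {s t : List α} (b : List α) (h : s < t) (hl : s.length = t.length) :
    s ++ b < t ++ b := by
  induction s generalizing t with
  | nil => cases t with
    | nil => exact absurd h (lt_irrefl _)
    | cons => simp at hl
  | cons a s ih => cases t with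
    | nil => simp at hl
    | cons c t =>
      rw [List.cons_lt_cons_iff] at h
      rw [List.cons_append, List.cons_append, List.cons_lt_cons_iff]
      exact h.imp_right fun h => ⟨h.1, ih h.2 (by simpa using hl)⟩

/-- Lyndon words are unbordered: a border `b` gives factorizations `s ++ b = b ++ t` of the word,
and comparing it with its rotations `b ++ s` and `t ++ b` gives `t < s` and `s < t`. -/
theorem IsLyndonSeq.not_period (hf : IsLyndonSeq f p) (hq₀ : 0 < q) (hq : q < p)
    (h : ∀ j, j + q < p → f (j + q) = f j) : False := by
  have hb : window f q (p - q) = window f 0 (p - q) := by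
    rw [window_eq_window_iff]; intro t ht
    rw [add_comm, h t (by omega), zero_add]
  have hp0 (n : ℕ) : window f p n = window f 0 n := by
    rw [← window_mod hf.periodic, Nat.mod_self]
  have h₁ := hf.lt_rotation q hq₀ hq
  have h₂ := hf.lt_rotation (p - q) (by omega) (by omega)
  have e₁ (i : ℕ) : window f i p = window f i (p - q) ++ window f (i + (p - q)) q := by
    rw [← window_add, Nat.sub_add_cancel hq.le]
  have e₂ (i : ℕ) : window f i p = window f i q ++ window f (i + q) (p - q) := by
    rw [← window_add, Nat.add_sub_cancel' hq.le]
  rw [e₁, e₁ q, hb, Nat.add_sub_cancel' hq.le, zero_add, hp0] at h₁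
  rw [e₂, e₂ (p - q), Nat.sub_add_cancel hq.le, zero_add, hp0, hb] at h₂
  have h₃ : window f (p - q) q < window f 0 q := by
    by_contra hc
    rcases (not_lt.1 hc).lt_or_eq with hc | hc
    · exact lt_asymm h₁ (List.append_left_lt hc)
    · rw [hc] at h₁; exact lt_irrefl _ h₁
  exact lt_asymm h₂ (append_lt_append_right _ h₃ (by simp))

/-- A Lyndon word of length `p` that occurs in a sequence of period `q` has `p ≤ q`. -/
theorem IsLyndonSeq.le_of_agree (hf : IsLyndonSeq f p) (hg : IsLyndonSeq g q) {i : ℕ}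
    (h : ∀ t < p, f t = g (i + t)) : p ≤ q := by
  by_contra hc
  refine hf.not_period hg.pos (not_le.1 hc) fun j hj => ?_
  rw [h _ hj, h _ (by omega), ← add_assoc, hg.periodic]

/-- A Lyndon word has no second Lyndon word among its rotations: each would be strictly smaller than
the other. -/
theorem IsLyndonSeq.eq_zero_of_agree (hf : IsLyndonSeq f p) (hg : IsLyndonSeq g p) {i : ℕ}
    (hi : i < p) (h : ∀ t < p, f t = g (i + t)) : i = 0 := by
  by_contra hc
  have h' := eq_of_window_eq hf.periodic hg.periodic hg.pos h
  have h₁ := hg.lt_rotation i (Nat.pos_of_ne_zero hc) hi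
  have h₂ := hf.lt_rotation (p - i) (by omega) (by omega)
  have e₁ : window f 0 p = window g i p := by
    rw [window_eq_window_iff]; intro t _; rw [zero_add, h']
  have e₂ : window f (p - i) p = window g 0 p := by
    rw [window_eq_window_iff]; intro t _
    rw [h', zero_add, ← add_assoc, Nat.add_sub_cancel' hi.le, add_comm, hg.periodic]
  rw [e₁, e₂] at h₂
  exact lt_asymm h₁ h₂

/-- A Lyndon sequence is determined by any window from the origin that covers a period. -/
theorem IsLyndonSeq.ext (hf : IsLyndonSeq f p) (hg : IsLyndonSeq g q) {n : ℕ} (hp : p ≤ n)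
    (hq : q ≤ n) (h : window f 0 n = window g 0 n) : p = q ∧ f = g := by
  rw [window_eq_window_iff] at h
  simp only [zero_add] at h
  obtain rfl : p = q := le_antisymm
    (hf.le_of_agree (i := 0) hg fun t ht => by rw [zero_add, h t (by omega)])
    (hg.le_of_agree (i := 0) hf fun t ht => by rw [zero_add, h t (by omega)])
  refine ⟨rfl, funext fun t => ?_⟩
  have := eq_of_window_eq (q := 0) hf.periodic hg.periodic hf.pos
    (fun t ht => by rw [zero_add, h t (by omega)]) t
  rwa [zero_add] at this

/-- A periodic sequence is a shift of a Lyndon sequence, whose length is the least period: the shift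
is chosen to minimize the word formed by the first period. -/
theorem exists_isLyndonSeq {m : ℕ} (hf : Periodic f m) (hm : 0 < m) :
    ∃ g p k j, IsLyndonSeq g p ∧ 0 < k ∧ m = k * p ∧ j < p ∧ ∀ t, f t = g (j + t) := by
  classical
  have hex : ∃ p, 0 < p ∧ Periodic f p := ⟨m, hm, hf⟩
  obtain ⟨hp, hfp⟩ := Nat.find_spec hex
  have hmin : ∀ q, 0 < q → Periodic f q → Nat.find hex ≤ q :=
    fun q h₀ h => Nat.find_min' hex ⟨h₀, h⟩
  generalize Nat.find hex = p at hp hfp hmin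
  have hdvd : p ∣ m := by
    rw [Nat.dvd_iff_mod_eq_zero]
    by_contra hc
    refine absurd (hmin _ (Nat.pos_of_ne_zero hc) fun x => ?_) (not_le.2 (Nat.mod_lt m hp))
    rw [← hfp.map_mod_nat, Nat.add_mod_mod, hfp.map_mod_nat, hf]
  obtain ⟨k, rfl⟩ := hdvd
  obtain ⟨i, hi, hle⟩ := (Finset.range p).exists_min_image (fun i => window f i p)
    ⟨0, Finset.mem_range.2 hp⟩
  rw [Finset.mem_range] at hi
  have hgp : Periodic (fun t => f (i + t)) p := fun t => by
    change f (i + (t + p)) = f (i + t)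
    rw [← add_assoc, hfp]
  have hw (j : ℕ) : window (fun t => f (i + t)) j p = window f (i + j) p := by
    rw [window_eq_window_iff]; intro t _; rw [add_assoc]
  have hback (t : ℕ) : f t = f (i + ((p - i) % p + t)) := by
    rw [← hfp.map_mod_nat (i + _), ← add_assoc, ← Nat.mod_add_mod (i + _), Nat.add_mod_mod,
      Nat.add_sub_cancel' hi.le, Nat.mod_self, zero_add, hfp.map_mod_nat]
  refine ⟨fun t => f (i + t), p, k, (p - i) % p, ⟨hp, hgp, fun j hj₀ hj => ?_⟩,
    Nat.pos_of_ne_zero fun h => by simp [h] at hm, mul_comm .., Nat.mod_lt _ hp, hback⟩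
  rw [hw, hw, add_zero]
  refine lt_of_le_of_ne ?_ fun heq => ?_
  · rw [← window_mod hfp (i + j)]
    exact hle _ (Finset.mem_range.2 (Nat.mod_lt _ hp))
  · rw [window_eq_window_iff] at heq
    refine absurd (hmin j hj₀ fun t => ?_) (not_le.2 hj)
    have := eq_of_window_eq (f := fun t => f (i + t)) (g := fun t => f (i + t)) (q := j) hgp hgp hp
      (fun t ht => by rw [heq t ht, add_assoc])
    rw [hback (t + j), hback t]
    convert this _ |>.symm using 2
    ring

end Lyndon

/-! ### Rauzy graphs -/

section Rauzy
variable {α : Type*}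

theorem finite_factors (w : List α) (n : ℕ) : (factors w n).Finite :=
  (List.finite_toSet w.sublists).subset fun _ hs => List.mem_sublists.2 hs.1.sublist

theorem circuitEdges_subset_factors [LinearOrder α] (w : List α) (n : ℕ) :
    circuitEdges w n ⊆ factors w (n + 1) := by
  rintro _ ⟨f, p, -, -, rfl, h⟩
  exact ⟨h 0, length_window ..⟩

/-- The Rauzy graph is connected: a function on its vertices that takes equal values at the two ends
of every edge is constant, because the windows of `w` form a walk through all vertices. -/
theorem eq_of_factors {β : Type*} {w : List α} {n : ℕ} (g : List α → β)
    (h : ∀ e ∈ factors w (n + 1), g e.tail = g (e.take n)) :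
    ∀ s ∈ factors w n, g s = g (w.take n) := by
  have key (i : ℕ) (hi : i + n ≤ w.length) : g ((w.drop i).take n) = g (w.take n) := by
    induction i with
    | zero => rfl
    | succ i ih =>
      rw [← ih (by omega)]
      have := h ((w.drop i).take (n + 1)) ⟨⟨w.take i, (w.drop i).drop (n + 1), by
        rw [List.append_assoc, List.take_append_drop, List.take_append_drop]⟩, by simp; omega⟩
      rw [List.take_take, min_eq_left (Nat.le_succ n)] at this
      rw [← this, ← List.drop_one, List.drop_take, List.drop_drop, Nat.add_sub_cancel]
  rintro s ⟨⟨a, b, rfl⟩, rfl⟩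
  simpa using key a.length (by simp)

/-- Deleting the distinguished edges does not disconnect the Rauzy graph: a function on the vertices
that takes equal values at the two ends of every remaining edge does so on the deleted edges too. -/
theorem eq_of_not_mem_circuitEdges [LinearOrder α] {β : Type*} {w : List α} {n : ℕ}
    (g : List α → β)
    (h : ∀ e ∈ factors w (n + 1), e ∉ circuitEdges w n → g e.tail = g (e.take n)) :
    ∀ e ∈ factors w (n + 1), g e.tail = g (e.take n) := by
  -- The ends of a deleted edge are joined by the rest of its circuit, where any further deleted edge
  -- belongs to a shorter circuit.
  have key (p : ℕ) : ∀ f, IsLyndonSeq f p → p ≤ n → (∀ i, window f i (n + 1) <:+: w) →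
      g (window f 1 n) = g (window f 0 n) := by
    induction p using Nat.strong_induction_on with
    | _ p ih =>
    intro f hf hpn hw
    have hstep (i : ℕ) (hi₀ : 0 < i) (hi : i < p) :
        g (window f (i + 1) n) = g (window f i n) := by
      rw [← tail_window, ← take_window f i n]
      by_cases he : window f i (n + 1) ∈ circuitEdges w n
      · obtain ⟨f', p', hf', hpn', heq, hw'⟩ := he
        rw [heq, tail_window, take_window]
        rw [eq_comm, window_eq_window_iff] at heq
        simp only [zero_add] at heq
        have hle : p' ≤ p := hf'.le_of_agree hf fun t ht => heq t (by omega)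
        refine ih p' (lt_of_le_of_ne hle fun hpp => ?_) f' hf' hpn' hw'
        subst hpp
        exact hi₀.ne' (hf'.eq_zero_of_agree hf hi fun t ht => heq t (by omega))
      · exact h _ ⟨hw i, length_window ..⟩ he
    have hall (i : ℕ) (hi₀ : 0 < i) (hi : i ≤ p) : g (window f i n) = g (window f 1 n) := by
      induction i with
      | zero => exact absurd hi₀ (lt_irrefl _)
      | succ i ih' =>
        rcases Nat.eq_zero_or_pos i with rfl | hi'
        · rfl
        · rw [hstep i hi' hi, ih' hi' (by omega)]
    rw [← hall p hf.pos le_rfl, ← window_mod hf.periodic, Nat.mod_self]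
  intro e he
  by_cases hc : e ∈ circuitEdges w n
  · obtain ⟨f, p, hf, hpn, rfl, hw⟩ := hc
    rw [tail_window, take_window]
    exact key p f hf hpn hw
  · exact h e he hc

/-- In a connected graph the number of vertices exceeds that of edges by at most one; applied to the
Rauzy graph without its distinguished edges. -/
theorem ncard_factors_add_ncard_circuitEdges_le [LinearOrder α] (w : List α) (n : ℕ) :
    (factors w n).ncard + (circuitEdges w n).ncard ≤ (factors w (n + 1)).ncard + 1 := by
  classical
  have := (finite_factors w n).fintype
  have := ((finite_factors w (n + 1)).sdiff (t := circuitEdges w n)).fintype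
  have htail {e : List α} (he : e ∈ factors w (n + 1)) : e.tail ∈ factors w n :=
    ⟨(List.tail_suffix e).isInfix.trans he.1, by simp [he.2]⟩
  have htake {e : List α} (he : e ∈ factors w (n + 1)) : e.take n ∈ factors w n :=
    ⟨(List.take_prefix n e).isInfix.trans he.1, by simp [he.2]⟩
  let zeroExt (g : factors w n → ℚ) (s : List α) : ℚ := if h : s ∈ factors w n then g ⟨s, h⟩ else 0
  -- `φ` sends a function on the vertices to its value at one vertex and its increments along the
  -- remaining edges; connectedness makes it injective.
  let φ : (factors w n → ℚ) →ₗ[ℚ]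
      (Option ↥(factors w (n + 1) \ circuitEdges w n) → ℚ) :=
    { toFun := fun g o => o.elim (zeroExt g (w.take n)) fun e =>
        zeroExt g e.1.tail - zeroExt g (e.1.take n)
      map_add' := fun g g' => by
        ext o
        cases o with
        | none => simp only [Option.elim, zeroExt, Pi.add_apply]; split_ifs <;> simp
        | some e =>
          simp only [Option.elim, zeroExt, Pi.add_apply, htail e.2.1, htake e.2.1, dif_pos]; ring
      map_smul' := fun c g => by
        ext o
        cases o with
        | none => simp only [Option.elim, zeroExt, Pi.smul_apply]; split_ifs <;> simp
        | some e =>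
          simp only [Option.elim, zeroExt, Pi.smul_apply, htail e.2.1, htake e.2.1, dif_pos,
            smul_eq_mul, RingHom.id_apply]; ring }
  have hφ : Injective φ := by
    rw [← LinearMap.ker_eq_bot, LinearMap.ker_eq_bot']
    intro g hg
    have h₀ : zeroExt g (w.take n) = 0 := congrFun hg none
    have h₁ := eq_of_factors (zeroExt g) (eq_of_not_mem_circuitEdges (zeroExt g) fun e he hc =>
      sub_eq_zero.1 (congrFun hg (some ⟨e, he, hc⟩)))
    refine funext fun ⟨s, hs⟩ => ?_
    have := h₁ s hs
    rw [h₀] at this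
    simp only [zeroExt, dif_pos hs] at this
    exact this
  have := LinearMap.finrank_le_finrank_of_injective hφ
  rw [Module.finrank_fintype_fun_eq_card, Module.finrank_fintype_fun_eq_card, Fintype.card_option,
    ← Nat.card_eq_fintype_card, ← Nat.card_eq_fintype_card, Nat.card_coe_set_eq,
    Nat.card_coe_set_eq] at this
  have h₂ := Set.ncard_sdiff_add_ncard_of_subset (circuitEdges_subset_factors w n)
    (finite_factors w (n + 1))
  omega

theorem sum_ncard_circuitEdges_le [LinearOrder α] (w : List α) (n : ℕ) :
    (factors w 1).ncard + ∑ i ∈ Finset.Ico 1 (n + 1), (circuitEdges w i).ncard ≤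
      (factors w (n + 1)).ncard + n := by
  induction n with
  | zero => simp
  | succ n ih =>
    rw [Finset.sum_Ico_succ_top (by omega)]
    have := ncard_factors_add_ncard_circuitEdges_le w (n + 1)
    omega

theorem ncard_factors_length (w : List α) : (factors w w.length).ncard = 1 := by
  rw [Set.ncard_eq_one]
  exact ⟨w, Set.ext fun s =>
    ⟨fun h => h.1.eq_of_length h.2, by rintro rfl; exact ⟨List.infix_rfl, rfl⟩⟩⟩

theorem ncard_factors_one (w : List α) : (factors w 1).ncard = (Alph w).ncard := by
  have : factors w 1 = (fun a => [a]) '' Alph w := by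
    ext s
    constructor
    · rintro ⟨h, hl⟩
      obtain ⟨a, rfl⟩ := List.length_eq_one_iff.1 hl
      exact ⟨a, h.subset (by simp), rfl⟩
    · rintro ⟨a, ha, rfl⟩
      obtain ⟨s, t, rfl⟩ := List.append_of_mem ha
      exact ⟨⟨s, t, by simp⟩, rfl⟩
  rw [this, Set.ncard_image_of_injective _ fun a b h => by simpa using h]

end Rauzy

/-! ### Squares -/

section Squares
variable {α : Type*} [LinearOrder α]

/-- Every nonempty square is a window, of length an even multiple of the period, of a Lyndon
sequence: the conjugate Lyndon word of its primitive root. -/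
theorem exists_window_of_square {u : List α} (hu : u ≠ []) :
    ∃ f p k j, IsLyndonSeq f p ∧ 0 < k ∧ j < p ∧ u ++ u = window f j (2 * (k * p)) := by
  have hl : 0 < u.length := List.length_pos_iff.2 hu
  let f : ℕ → α := fun t => u[t % u.length]'(Nat.mod_lt _ hl)
  have hf : Periodic f u.length := fun t => by simp [f]
  obtain ⟨g, p, k, j, hg, hk, hm, hj, h⟩ := exists_isLyndonSeq hf hl
  refine ⟨g, p, k, j, hg, hk, hj, ?_⟩
  have h₁ : u = window f 0 u.length := by
    refine List.ext_getElem (by simp) fun i hi _ => ?_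
    simp [window, f, Nat.mod_eq_of_lt hi]
  have h₂ : u ++ u = window f 0 (2 * u.length) := by
    rw [two_mul, window_add, zero_add, ← window_mod hf u.length, Nat.mod_self, ← h₁]
  rw [h₂, ← hm, window_eq_window_iff]
  intro t _
  rw [zero_add, h]

/-- The phases `j < p` at which the window of `f` of length `2kp` is a factor of `w`. When `f` has
period `p`, these windows are the squares in `w` of the rotations of the `k`-th power of the first
period of `f`. -/
def squarePhases (w : List α) (f : ℕ → α) (p k : ℕ) : Finset ℕ := by
  classical exact (Finset.range p).filter fun j => window f j (2 * (k * p)) <:+: w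

theorem mem_squarePhases {w : List α} {f : ℕ → α} {p k j : ℕ} :
    j ∈ squarePhases w f p k ↔ j < p ∧ window f j (2 * (k * p)) <:+: w := by
  simp [squarePhases]

theorem squarePhases_subset (w : List α) (f : ℕ → α) (p k : ℕ) :
    squarePhases w f p k ⊆ Finset.range p :=
  fun _ hj => Finset.mem_range.2 (mem_squarePhases.1 hj).1

theorem card_squarePhases_le (w : List α) (f : ℕ → α) (p k : ℕ) :
    (squarePhases w f p k).card ≤ p := by
  simpa using Finset.card_le_card (squarePhases_subset w f p k)

/-- If more than `r` phases give squares, every window of length `kp + r + 1` is a factor of `w`.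
A square covers the windows of that length at `kp - r ≥ p - r` consecutive positions, and the
`p - r` residues from which the window at `i` would be covered cannot all avoid the phases. -/
theorem window_isInfix_of_lt_card {w : List α} {f : ℕ → α} {p k r : ℕ} (hf : Periodic f p)
    (hk : 0 < k) (hr : r < (squarePhases w f p k).card) (i : ℕ) :
    window f i (k * p + r + 1) <:+: w := by
  have hcard := card_squarePhases_le w f p k
  have hkp : p ≤ k * p := Nat.le_mul_of_pos_left p hk
  obtain ⟨j, hj, t, ht, hjt⟩ : ∃ j ∈ squarePhases w f p k, ∃ t < p - r, (j + t) % p = i % p := by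
    by_contra! hc
    -- The residues of `i - t` modulo `p` for `t < p - r` are distinct and avoid the phases.
    have hinj : Set.InjOn (fun t => (i + (p - t)) % p) (Finset.range (p - r)) := by
      intro t ht t' ht' h
      simp only [Finset.coe_range, Set.mem_Iio] at ht ht'
      have h' : i + (p - t) ≡ i + (p - t') [MOD p] := h
      have h'' := Nat.ModEq.add_left_cancel' i h'
      have h3 : p - t + (t + t') ≡ p - t' + (t + t') [MOD p] := h''.add_right _
      have e₁ : p - t + (t + t') = t' + p := by omega
      have e₂ : p - t' + (t + t') = t + p := by omega
      rw [e₁, e₂] at h3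
      have h4 := Nat.ModEq.add_right_cancel' p h3
      rw [Nat.ModEq, Nat.mod_eq_of_lt (by omega), Nat.mod_eq_of_lt (by omega)] at h4
      exact h4.symm
    have hdisj : Disjoint (squarePhases w f p k)
        ((Finset.range (p - r)).image fun t => (i + (p - t)) % p) := by
      rw [Finset.disjoint_left]
      intro j hj hj'
      obtain ⟨t, ht, rfl⟩ := Finset.mem_image.1 hj'
      rw [Finset.mem_range] at ht
      refine hc _ hj t ht ?_
      rw [Nat.mod_add_mod, add_assoc, Nat.sub_add_cancel (by omega), Nat.add_mod_right]
    have hsub := Finset.card_le_card (Finset.union_subset (squarePhases_subset w f p k)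
      (Finset.image_subset_iff (s := Finset.range (p - r)) (f := fun t => (i + (p - t)) % p).2
        fun t _ => Finset.mem_range.2 (Nat.mod_lt _ (by omega))))
    rw [Finset.card_union_of_disjoint hdisj, Finset.card_image_of_injOn hinj, Finset.card_range,
      Finset.card_range] at hsub
    omega
  rw [← window_mod hf, ← hjt, window_mod hf]
  exact (window_isInfix (by omega) (by omega)).trans (mem_squarePhases.1 hj).2

theorem ncard_squares_le (w : List α) :
    (squareFactors w \ {[]}).ncard ≤
      ∑ i ∈ Finset.Ico 1 w.length, (circuitEdges w i).ncard := by
  classical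
  rcases isEmpty_or_nonempty α with hα | hα
  · have : squareFactors w \ {[]} = ∅ :=
      Set.eq_empty_of_forall_notMem fun s hs => hs.2 (Subsingleton.elim s [])
    simp [this]
  have hfin (n : ℕ) : (circuitEdges w n).Finite :=
    (finite_factors w (n + 1)).subset (circuitEdges_subset_factors w n)
  have hsq (s : List α) (hs : s ∈ squareFactors w \ {[]}) : ∃ f p k j, IsLyndonSeq f p ∧ 0 < k ∧
      j ∈ squarePhases w f p k ∧ s = window f j (2 * (k * p)) := by
    obtain ⟨⟨hw, u, rfl⟩, hne⟩ := hs
    obtain ⟨f, p, k, j, hf, hk, hj, h⟩ := exists_window_of_square (u := u)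
      (by rintro rfl; exact hne rfl)
    exact ⟨f, p, k, j, hf, hk, mem_squarePhases.2 ⟨hj, h ▸ hw⟩, h⟩
  choose! f p k j hf hk hj hs using hsq
  -- `rank s < p s` is the position of the phase of `s` among all phases with the same `f`, `p`, `k`.
  let rank (s : List α) : ℕ := ((squarePhases w (f s) (p s) (k s)).filter (· < j s)).card
  have hrank (s) (h : s ∈ squareFactors w \ {[]}) :
      rank s < (squarePhases w (f s) (p s) (k s)).card :=
    Finset.card_lt_card <| Finset.filter_ssubset.2 ⟨j s, hj s h, lt_irrefl _⟩
  let E := (Finset.Ico 1 w.length).biUnion fun i => (hfin i).toFinset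
  calc (squareFactors w \ {[]}).ncard ≤ (E : Set (List α)).ncard := by
        refine Set.ncard_le_ncard_of_injOn
          (fun s => window (f s) 0 (k s * p s + rank s + 1)) (fun s h => ?_) (fun s h s' h' heq => ?_)
          E.finite_toSet
        · have hin := window_isInfix_of_lt_card (hf s h).periodic (hk s h) (hrank s h)
          have hkp := Nat.le_mul_of_pos_left (p s) (hk s h)
          have hlen := (hin 0).length_le
          have hpos := (hf s h).pos
          rw [length_window] at hlen
          simp only [E, Finset.coe_biUnion, Set.mem_iUnion, Finset.mem_coe, Set.Finite.mem_toFinset,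
            Finset.mem_Ico]
          exact ⟨k s * p s + rank s, ⟨by omega, by omega⟩, f s, p s, hf s h, by omega, rfl, hin⟩
        · have hl := congrArg List.length heq
          simp only [length_window] at hl
          have hkp := Nat.le_mul_of_pos_left (p s) (hk s h)
          have hkp' := Nat.le_mul_of_pos_left (p s') (hk s' h')
          have heq' : window (f s) 0 (k s * p s + rank s + 1) =
            window (f s') 0 (k s' * p s' + rank s' + 1) := heq
          rw [← hl] at heq'
          obtain ⟨hp, hff⟩ := (hf s h).ext (hf s' h') (by omega) (by omega) heq'
          have hr := (hrank s h).trans_le (card_squarePhases_le ..)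
          have hr' := (hrank s' h').trans_le (card_squarePhases_le ..)
          rw [← hp] at hr' hl
          -- `k` and the rank are quotient and remainder of the level by `p`.
          have hkk : k s = k s' := by
            have h₁ : (k s * p s + rank s) / p s = k s := by
              rw [mul_comm, Nat.mul_add_div (hf s h).pos, Nat.div_eq_of_lt hr, add_zero]
            have h₂ : (k s' * p s + rank s') / p s = k s' := by
              rw [mul_comm, Nat.mul_add_div (hf s h).pos, Nat.div_eq_of_lt hr', add_zero]
            rw [← h₁, ← h₂, Nat.succ_injective hl]
          have hrr : rank s = rank s' := by rw [hkk] at hl; omega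
          have hjj : j s = j s' := by
            have hj₁ := hj s h
            have hj₂ := hj s' h'
            simp only [rank] at hrr
            rw [← hff, ← hp, ← hkk] at hrr hj₂
            by_contra hne
            rcases Nat.lt_or_gt_of_ne hne with hlt | hlt
            · refine hrr.not_lt (Finset.card_lt_card ((Finset.ssubset_iff_of_subset
                (Finset.monotone_filter_right _ fun x _ hx => ?_)).2 ⟨j s, ?_, ?_⟩))
              · exact lt_trans hx hlt
              · exact Finset.mem_filter.2 ⟨hj₁, hlt⟩
              · simp
            · refine hrr.not_gt (Finset.card_lt_card ((Finset.ssubset_iff_of_subset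
                (Finset.monotone_filter_right _ fun x _ hx => ?_)).2 ⟨j s', ?_, ?_⟩))
              · exact lt_trans hx hlt
              · exact Finset.mem_filter.2 ⟨hj₂, hlt⟩
              · simp
          rw [hs s h, hs s' h', hff, hp, hkk, hjj]
    _ ≤ ∑ i ∈ Finset.Ico 1 w.length, (circuitEdges w i).ncard := by
        rw [Set.ncard_coe_finset]
        refine Finset.card_biUnion_le.trans_eq (Finset.sum_congr rfl fun i _ => ?_)
        rw [Set.ncard_eq_toFinset_card _ (hfin i)]

end Squares

theorem theorem1 {α : Type*} (w : List α) :
    (S w : ℤ) ≤ (w.length : ℤ) - ((Alph w).ncard : ℤ) + 1 := by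
  classical
  -- The statement does not depend on an order of the letters, so any one will do.
  let _ : LinearOrder α := linearOrderOfSTO WellOrderingRel
  have h₀ : (squareFactors w \ {[]}).ncard + 1 = S w :=
    Set.ncard_sdiff_singleton_add_one ⟨List.nil_infix, [], rfl⟩ (squareFactors_finite w)
  have h₁ := ncard_squares_le w
  have h₂ : (Alph w).ncard + ∑ i ∈ Finset.Ico 1 w.length, (circuitEdges w i).ncard ≤ w.length := by
    rcases Nat.eq_zero_or_pos w.length with h | h
    · obtain rfl := List.length_eq_zero_iff.1 h
      simp [Alph]
    · have := sum_ncard_circuitEdges_le w (w.length - 1)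
      rw [Nat.sub_add_cancel h, ncard_factors_length, ncard_factors_one] at this
      omega
  omega
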